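/- An s-partition is a partition of a finite set $S$ of integers (its support) into a set of nonempty lists, called blocks; it is standard if $S=\{1,\dots,n\}$ for some $n\ge 0$. A run is a block consisting of consecutive integers in increasing order. Fix a positive integer $j$. An s-partition is $j$-compatible if every block has length divisible by $j$; its size is then $|S|/j$. A $j$-run is a run whose length and last entry are both divisible by $j$. To delete a run from a standard s-partition, remove it and standardize what is left (replace the smallest entry by $1$, the second smallest by $2$, and so on). To insert a run $i+1,\dots,i+\ell$ with $0\le i\le|S|$ into a standard s-partition, add $\ell$ to every entry exceeding $i$ and adjoin $i+1,\dots,i+\ell$ as a new block. A $j$-run-closed family is a set of standard $j$-compatible s-partitions closed under insertion and deletion of $j$-runs. Theorem. Let $\mathcal F$ be a $j$-run-closed family of $j$-compatible s-partitions and let $f(x)=\sum_{n\ge 0} f_n x^n$, where $f_n$ is the number of members of $\mathcal F$ of size $n$. Then the run transform $$F(x,y)=\frac{1-x}{1-xy}\; f\!\left(\frac{x(1-x)}{1-xy}\right)$$ of $f$ counts $\mathcal F$ by size and number of $j$-runs: for all $n,k\ge 0$, the coefficient of $x^n y^k$ in $F(x,y)$ is the number of members of $\mathcal F$ of size $n$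 with exactly $k$ blocks that are $j$-runs. -/

import Mathlib

namespace SPartition

/-- The support of a finite set of lists: the set of all entries of its blocks. -/
def support (π : Finset (List ℕ)) : Finset ℕ :=
  π.biUnion List.toFinset

/-- A finite set of lists is an s-partition (a partition of its support into a set of lists) if
its blocks are nonempty lists without repeated entries and distinct blocks share no entry. -/
structure IsSPartition (π : Finset (List ℕ)) : Prop where
  nonempty : ∀ B ∈ π, B ≠ []
  nodup : ∀ B ∈ π, B.Nodup
  disjoint : ∀ B ∈ π, ∀ B' ∈ π, B ≠ B' → List.Disjoint B B'

/-- An s-partition is standard if its support is an initial segment `{1, …, n}` of the positive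
integers (`n = 0` gives the empty s-partition). -/
def IsStandard (π : Finset (List ℕ)) : Prop :=
  ∃ n : ℕ, support π = Finset.Icc 1 n

/-- Standardization: replace the smallest entry by 1, the second smallest by 2, and so on. -/
def standardize (π : Finset (List ℕ)) : Finset (List ℕ) :=
  π.image (List.map fun x => ((support π).filter (fun y => y ≤ x)).card)

/-- Every block has length divisible by `j`. -/
def IsCompatible (j : ℕ) (π : Finset (List ℕ)) : Prop :=
  ∀ B ∈ π, j ∣ B.length

/-- The size of a `j`-compatible s-partition: the cardinality of its support divided by `j`
(an exact division, since the support is the disjoint union of the blocks). -/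
def size (j : ℕ) (π : Finset (List ℕ)) : ℕ :=
  (support π).card / j

/-- A run is a nonempty list `a, a + 1, …, a + l - 1` of consecutive integers in
increasing order. -/
def IsRun (R : List ℕ) : Prop :=
  ∃ a l : ℕ, 0 < l ∧ R = List.range' a l

/-- A `j`-run is a run whose length and last entry are both divisible by `j`. -/
def IsJRun (j : ℕ) (R : List ℕ) : Prop :=
  IsRun R ∧ j ∣ R.length ∧ ∀ x ∈ R.getLast?, j ∣ x

/-- The number of blocks of `π` that are `j`-runs. -/
noncomputable def numJRuns (j : ℕ) (π : Finset (List ℕ)) : ℕ :=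
  {R : List ℕ | R ∈ π ∧ IsJRun j R}.ncard

/-- Delete the block `R`: remove it and standardize what is left. -/
def deleteRun (π : Finset (List ℕ)) (R : List ℕ) : Finset (List ℕ) :=
  standardize (π.erase R)

/-- Insert the run `i + 1, …, i + l`: increment by `l` all entries that exceed `i` and adjoin the
run as a new block. -/
def insertRun (π : Finset (List ℕ)) (i l : ℕ) : Finset (List ℕ) :=
  insert (List.range' (i + 1) l)
    (π.image (List.map fun x => if i < x then x + l else x))

/-- A `j`-run-closed family of `j`-compatible (standard) s-partitions: it is closed under the
deletion of `j`-runs and under every insertion of a `j`-run `i + 1, …, i + l` with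
`0 ≤ i ≤ #(support π)` (the condition for the result to be standard). -/
structure IsJRunClosed (j : ℕ) (F : Set (Finset (List ℕ))) : Prop where
  isSPartition : ∀ π ∈ F, IsSPartition π
  isStandard : ∀ π ∈ F, IsStandard π
  isCompatible : ∀ π ∈ F, IsCompatible j π
  delete_mem : ∀ π ∈ F, ∀ R ∈ π, IsJRun j R → deleteRun π R ∈ F
  insert_mem : ∀ π ∈ F, ∀ i l : ℕ, i ≤ (support π).card →
    IsJRun j (List.range' (i + 1) l) → insertRun π i l ∈ F

/-- The generating function by size `∑ₙ #{π ∈ F : size π = n} xⁿ`. -/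
noncomputable def sizeGF (j : ℕ) (F : Set (Finset (List ℕ))) : PowerSeries ℤ :=
  PowerSeries.mk fun n => (({π | π ∈ F ∧ size j π = n}.ncard : ℕ) : ℤ)

/-- The quotient `(1 - x) / (1 - x y)` as a power series in `x` over the polynomials in `y`. -/
noncomputable def runFactor (A : Type*) [CommRing A] : PowerSeries (Polynomial A) :=
  (1 - PowerSeries.X) *
    PowerSeries.invOfUnit (1 - PowerSeries.X * PowerSeries.C (Polynomial.X : Polynomial A)) 1

/-- The run transform `(1 - x) / (1 - x y) * f (x (1 - x) / (1 - x y))`, a power series in `x`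
whose coefficients are polynomials in `y`. -/
noncomputable def runTransform {A : Type*} [CommRing A] (f : PowerSeries A) :
    PowerSeries (Polynomial A) :=
  runFactor A * PowerSeries.subst (PowerSeries.X * runFactor A) f

/-- The denominator in `runFactor` is really inverted. -/
theorem runFactor_mul (A : Type*) [CommRing A] :
    runFactor A * (1 - PowerSeries.X * PowerSeries.C (Polynomial.X : Polynomial A)) =
      1 - PowerSeries.X := by
  rw [runFactor, mul_assoc, mul_comm (PowerSeries.invOfUnit _ _),
    PowerSeries.mul_invOfUnit _ _ (by simp), mul_one]

/-- The substitution in `runTransform` is legitimate. -/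
theorem hasSubst_runFactor (A : Type*) [CommRing A] :
    PowerSeries.HasSubst (PowerSeries.X * runFactor A : PowerSeries (Polynomial A)) :=
  PowerSeries.HasSubst.of_constantCoeff_zero' (by simp)

/-- There are finitely many standard s-partitions of each size, so that the cardinalities in
`sizeGF` are those of finite sets. -/
theorem finite_size {j : ℕ} (hj : 0 < j) (n : ℕ) :
    {π | IsSPartition π ∧ IsStandard π ∧ size j π = n}.Finite := by
  have hL : {B : List ℕ | B.Nodup ∧ B.toFinset ⊆ Finset.Icc 1 (j * (n + 1))}.Finite := by
    refine (((Finset.Icc 1 (j * (n + 1))).powerset.finite_toSet).biUnion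
      (t := fun s => {B : List ℕ | B ∈ s.val.lists}) fun s _ =>
        s.val.lists.toFinset.finite_toSet.subset fun B hB => by simpa using hB).subset ?_
    rintro B ⟨hB, hs⟩
    simp only [Set.mem_iUnion, Set.mem_ofPred_eq]
    refine ⟨B.toFinset, Finset.mem_coe.2 (Finset.mem_powerset.2 hs), ?_⟩
    rw [Multiset.mem_lists_iff, List.toFinset_val, hB.dedup]
    rfl
  refine (hL.toFinset.powerset.finite_toSet).subset ?_
  rintro π ⟨h, ⟨m, hm⟩, hn⟩
  simp only [Finset.coe_powerset, Set.mem_preimage, Set.mem_powerset_iff]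
  intro B hB
  have hmn : m ≤ j * (n + 1) := by
    have : m / j = n := by simpa [size, hm] using hn
    exact ((Nat.div_lt_iff_lt_mul hj).1 (by omega : m / j < n + 1)).le.trans (by rw [mul_comm])
  simp only [Set.Finite.coe_toFinset, Set.mem_ofPred_eq]
  refine ⟨h.nodup B hB, fun x hx => ?_⟩
  have : x ∈ support π := Finset.mem_biUnion.2 ⟨B, hB, hx⟩
  rw [hm, Finset.mem_Icc] at this
  exact Finset.mem_Icc.2 ⟨this.1, this.2.trans hmn⟩

end SPartition

/-!
The theorem becomes a positive count after replacing `y` by `y + 1`: the left side then counts the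
members of `F` together with a set of marked `j`-runs, each marked run contributing a factor `y`.
Since the marked runs can be deleted and reinserted without leaving `F`, a member with `m` marked
runs amounts to an arbitrary member of some size `u` together with a distribution of `m` runs over
the `u + 1` positions after the entries `0, j, 2 j, …, u j`; so the members of size `u` contribute
`f_u x^u ∑ₘ C(u + m, m) y^m (x / (1 - x))^m = f_u x^u (1 - y x / (1 - x))^(-(u + 1))`. On the
algebraic side, `(1 - x) / (1 - x y)` becomes `1 / (1 - y x / (1 - x))` under the shift, which
gives the same series.

The distributions of runs are not described explicitly. Instead one marked run at a time is deleted
(`card_markings_succ`). Distinguishing one of the `m + 1` marked runs and deleting it is a bijection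
onto the choices of a pair with `m` marked runs, the length of a new run and a position for it that
splits none of the marked runs. There are always `u + m + 1` such positions
(`IsMarking.card_freePositions`), however long the marked runs are. The resulting recurrence
determines the number of marked pairs (`card_markings`), and `coeff_runTransform_sizeGF` compares
this number with the coefficients of the shifted run transform.
-/

namespace SPartition

/-! ### Opening and closing a gap -/

/-- The relabelling that makes room for the entries `i + 1, …, i + l`. -/
def openGap (i l x : ℕ) : ℕ := if i < x then x + l else x

/-- The relabelling that removes the unused entries `i + 1, …, i + l`. -/
def closeGap (i l x : ℕ) : ℕ := if i < x then x - l else x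

theorem openGap_injective (i l : ℕ) : Function.Injective (openGap i l) := by
  intro x y h
  unfold openGap at h
  split_ifs at h <;> omega

theorem openGap_notMem_gap (i l x : ℕ) : openGap i l x ∉ Finset.Icc (i + 1) (i + l) := by
  unfold openGap
  split_ifs <;> simp <;> omega

theorem openGap_closeGap {i l x : ℕ} (hx : x ∉ Finset.Icc (i + 1) (i + l)) :
    openGap i l (closeGap i l x) = x := by
  simp only [Finset.mem_Icc, not_and, not_le] at hx
  unfold openGap closeGap
  split_ifs <;> omega

theorem mem_support {π : Finset (List ℕ)} {x : ℕ} : x ∈ support π ↔ ∃ B ∈ π, x ∈ B := by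
  simp [support]

theorem insertRun_eq (π : Finset (List ℕ)) (i l : ℕ) :
    insertRun π i l = insert (List.range' (i + 1) l) (π.image (List.map (openGap i l))) := rfl

theorem mem_run {i l x : ℕ} : x ∈ List.range' (i + 1) l ↔ x ∈ Finset.Icc (i + 1) (i + l) := by
  simp only [List.mem_range'_1, Finset.mem_Icc]
  omega

theorem map_openGap_map_closeGap {i l : ℕ} {B : List ℕ}
    (hB : ∀ x ∈ B, x ∉ Finset.Icc (i + 1) (i + l)) :
    (B.map (closeGap i l)).map (openGap i l) = B := by
  rw [List.map_map]
  refine (List.map_congr_left fun x hx => ?_).trans (List.map_id B)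
  exact openGap_closeGap (hB x hx)

theorem image_openGap_image_closeGap {i l : ℕ} {π : Finset (List ℕ)}
    (h : ∀ B ∈ π, ∀ x ∈ B, x ∉ Finset.Icc (i + 1) (i + l)) :
    (π.image (List.map (closeGap i l))).image (List.map (openGap i l)) = π := by
  rw [Finset.image_image]
  refine (Finset.image_congr fun B hB => ?_).trans Finset.image_id
  exact map_openGap_map_closeGap (h B hB)

/-- The adjoined run is not among the relabelled old blocks. -/
theorem run_notMem_image_openGap {i l : ℕ} (hl : 0 < l) (π : Finset (List ℕ)) :
    List.range' (i + 1) l ∉ π.image (List.map (openGap i l)) := by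
  intro h
  obtain ⟨B, -, hB⟩ := Finset.mem_image.1 h
  have h1 : i + 1 ∈ List.range' (i + 1) l := mem_run.2 (by simp; omega)
  rw [← hB, List.mem_map] at h1
  obtain ⟨y, -, hy⟩ := h1
  exact openGap_notMem_gap i l y (by rw [hy]; simp; omega)

theorem support_insertRun {π : Finset (List ℕ)} {N i : ℕ} (l : ℕ)
    (h : support π = Finset.Icc 1 N) (hi : i ≤ N) :
    support (insertRun π i l) = Finset.Icc 1 (N + l) := by
  have hs : ∀ x, (∃ B ∈ π, x ∈ B) ↔ 1 ≤ x ∧ x ≤ N := fun x => by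
    rw [← mem_support, h, Finset.mem_Icc]
  ext x
  rw [mem_support, insertRun_eq, Finset.mem_Icc]
  constructor
  · rintro ⟨B, hB, hx⟩
    rcases Finset.mem_insert.1 hB with rfl | hB
    · rw [mem_run, Finset.mem_Icc] at hx
      omega
    · obtain ⟨C, hC, rfl⟩ := Finset.mem_image.1 hB
      obtain ⟨y, hy, rfl⟩ := List.mem_map.1 hx
      have := (hs y).1 ⟨C, hC, hy⟩
      unfold openGap
      split_ifs <;> omega
  · rintro hx
    by_cases hg : x ∈ Finset.Icc (i + 1) (i + l)
    · exact ⟨_, Finset.mem_insert_self _ _, mem_run.2 hg⟩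
    · have : 1 ≤ closeGap i l x ∧ closeGap i l x ≤ N := by
        simp only [Finset.mem_Icc, not_and, not_le] at hg
        unfold closeGap
        split_ifs <;> omega
      obtain ⟨B, hB, hy⟩ := (hs _).2 this
      refine ⟨B.map (openGap i l), Finset.mem_insert_of_mem (Finset.mem_image_of_mem _ hB), ?_⟩
      exact List.mem_map.2 ⟨_, hy, openGap_closeGap hg⟩

theorem IsSPartition.notMem_gap {π : Finset (List ℕ)} (hπ : IsSPartition π) {i l : ℕ}
    (hR : List.range' (i + 1) l ∈ π) {B : List ℕ} (hB : B ∈ π.erase (List.range' (i + 1) l))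
    {x : ℕ} (hx : x ∈ B) : x ∉ Finset.Icc (i + 1) (i + l) := fun h =>
  hπ.disjoint _ (Finset.mem_of_mem_erase hB) _ hR (Finset.ne_of_mem_erase hB) hx (mem_run.2 h)

theorem support_erase_run {π : Finset (List ℕ)} (hπ : IsSPartition π) {N i l : ℕ}
    (h : support π = Finset.Icc 1 N) (hR : List.range' (i + 1) l ∈ π) :
    support (π.erase (List.range' (i + 1) l)) = Finset.Icc 1 N \ Finset.Icc (i + 1) (i + l) := by
  ext x
  rw [Finset.mem_sdiff, ← h, mem_support, mem_support]
  constructor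
  · rintro ⟨B, hB, hx⟩
    exact ⟨⟨B, Finset.mem_of_mem_erase hB, hx⟩, hπ.notMem_gap hR hB hx⟩
  · rintro ⟨⟨B, hB, hx⟩, hg⟩
    refine ⟨B, Finset.mem_erase.2 ⟨?_, hB⟩, hx⟩
    rintro rfl
    exact hg (mem_run.1 hx)

theorem run_le_of_mem {π : Finset (List ℕ)} {N i l : ℕ} (hl : 0 < l)
    (h : support π = Finset.Icc 1 N) (hR : List.range' (i + 1) l ∈ π) : i + l ≤ N := by
  have : i + l ∈ support π := mem_support.2 ⟨_, hR, mem_run.2 (by simp; omega)⟩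
  rw [h, Finset.mem_Icc] at this
  exact this.2

/-- Standardizing after the removal of a run closes the gap that the run leaves. -/
theorem deleteRun_eq {π : Finset (List ℕ)} (hπ : IsSPartition π) {N i l : ℕ} (hl : 0 < l)
    (h : support π = Finset.Icc 1 N) (hR : List.range' (i + 1) l ∈ π) :
    deleteRun π (List.range' (i + 1) l) =
      (π.erase (List.range' (i + 1) l)).image (List.map (closeGap i l)) := by
  have hN := run_le_of_mem hl h hR
  unfold deleteRun standardize
  refine Finset.image_congr fun B hB => List.map_congr_left fun x hx => ?_
  have hg := hπ.notMem_gap hR hB hx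
  have hx' : x ∈ Finset.Icc 1 N :=
    h ▸ mem_support.2 ⟨B, Finset.mem_of_mem_erase hB, hx⟩
  rw [support_erase_run hπ h hR]
  simp only [Finset.mem_Icc, not_and, not_le] at hg hx'
  unfold closeGap
  split_ifs with hi
  · have : (Finset.Icc 1 N \ Finset.Icc (i + 1) (i + l)).filter (· ≤ x) =
        Finset.Icc 1 x \ Finset.Icc (i + 1) (i + l) := by
      ext y; simp only [Finset.mem_filter, Finset.mem_sdiff, Finset.mem_Icc]; omega
    rw [this, Finset.card_sdiff_of_subset]
    · simp
    · intro y; simp only [Finset.mem_Icc]; omega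
  · have : (Finset.Icc 1 N \ Finset.Icc (i + 1) (i + l)).filter (· ≤ x) = Finset.Icc 1 x := by
      ext y; simp only [Finset.mem_filter, Finset.mem_sdiff, Finset.mem_Icc]; omega
    simp [this]

theorem insertRun_deleteRun {π : Finset (List ℕ)} (hπ : IsSPartition π) {N i l : ℕ} (hl : 0 < l)
    (h : support π = Finset.Icc 1 N) (hR : List.range' (i + 1) l ∈ π) :
    insertRun (deleteRun π (List.range' (i + 1) l)) i l = π := by
  rw [insertRun_eq, deleteRun_eq hπ hl h hR, image_openGap_image_closeGap, Finset.insert_erase hR]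
  exact fun B hB x hx => hπ.notMem_gap hR hB hx

theorem support_deleteRun {π : Finset (List ℕ)} (hπ : IsSPartition π) {N i l : ℕ} (hl : 0 < l)
    (h : support π = Finset.Icc 1 N) (hR : List.range' (i + 1) l ∈ π) :
    support (deleteRun π (List.range' (i + 1) l)) = Finset.Icc 1 (N - l) := by
  have hN := run_le_of_mem hl h hR
  have hs : ∀ x, (∃ B ∈ π.erase (List.range' (i + 1) l), x ∈ B) ↔ _ := fun x => by
    rw [← mem_support, support_erase_run hπ h hR, Finset.mem_sdiff, Finset.mem_Icc]
  ext x
  rw [deleteRun_eq hπ hl h hR, mem_support, Finset.mem_Icc]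
  constructor
  · rintro ⟨B, hB, hx⟩
    obtain ⟨C, hC, rfl⟩ := Finset.mem_image.1 hB
    obtain ⟨y, hy, rfl⟩ := List.mem_map.1 hx
    have := (hs y).1 ⟨C, hC, hy⟩
    simp only [Finset.mem_Icc] at this
    unfold closeGap
    split_ifs <;> omega
  · intro hx
    have hgap := openGap_notMem_gap i l x
    obtain ⟨B, hB, hy⟩ := (hs (openGap i l x)).2 ⟨by unfold openGap; split_ifs <;> omega, hgap⟩
    refine ⟨_, Finset.mem_image_of_mem _ hB, List.mem_map.2 ⟨_, hy, ?_⟩⟩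
    exact openGap_injective i l (openGap_closeGap hgap)

/-! ### Runs aligned with multiples of `j` -/

/-- The `j`-runs with positive entries are the lists `j p + 1, …, j p + j c` with `c > 0`. The
hypothesis `0 ∉ R` excludes the `1`-runs that start with `0`, such as `[0]`. -/
theorem IsJRun.exists_eq {j : ℕ} {R : List ℕ} (h : IsJRun j R) (h0 : 0 ∉ R) :
    ∃ p c, 0 < c ∧ R = List.range' (j * p + 1) (j * c) := by
  obtain ⟨⟨a, l, hl, rfl⟩, ⟨c, hc⟩, h3⟩ := h
  rw [List.length_range'] at hc
  have ha : a ≠ 0 := by rintro rfl; exact h0 (by simp [List.mem_range'_1, hl])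
  have hlast := h3 (a + l - 1) (by
    rw [List.getLast?_range', if_neg hl.ne']; simp)
  obtain ⟨q, hq⟩ := hlast
  have hj : 0 < j := by rcases Nat.eq_zero_or_pos j with rfl | h <;> simp_all
  have hcq : c ≤ q := by
    by_contra hlt
    have := Nat.mul_le_mul_left j (show q + 1 ≤ c by omega)
    rw [Nat.mul_add] at this
    omega
  obtain ⟨p, rfl⟩ := Nat.exists_eq_add_of_le hcq
  refine ⟨p, c, ?_, ?_⟩
  · rcases Nat.eq_zero_or_pos c with rfl | h <;> simp_all
  · rw [hc]; congr 1; rw [Nat.mul_add] at hq; omega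

theorem isJRun_range' {j p c : ℕ} (hj : 0 < j) (hc : 0 < c) :
    IsJRun j (List.range' (j * p + 1) (j * c)) := by
  have h := Nat.mul_pos hj hc
  refine ⟨⟨_, _, h, rfl⟩, by simp, fun x hx => ?_⟩
  rw [List.getLast?_range', if_neg h.ne'] at hx
  simp only [Option.mem_def, Option.some.injEq] at hx
  exact ⟨p + c, by rw [Nat.mul_add]; omega⟩

/-- Opening a gap of length divisible by `j` that does not split a `j`-run keeps it a `j`-run. -/
theorem isJRun_map_openGap {j i d p c : ℕ} (hj : 0 < j) (hc : 0 < c)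
    (hi : ¬ (i ∈ List.range' (j * p + 1) (j * c) ∧ i + 1 ∈ List.range' (j * p + 1) (j * c))) :
    IsJRun j ((List.range' (j * p + 1) (j * c)).map (openGap i (j * d))) := by
  have h := Nat.mul_pos hj hc
  simp only [mem_run, Finset.mem_Icc] at hi
  rcases le_or_gt i (j * p) with hip | hip
  · have : (List.range' (j * p + 1) (j * c)).map (openGap i (j * d)) =
        List.range' (j * (p + d) + 1) (j * c) := by
      rw [show j * (p + d) + 1 = j * d + (j * p + 1) by ring, ← List.map_add_range' (a := j * d)]
      refine List.map_congr_left fun x hx => ?_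
      rw [mem_run, Finset.mem_Icc] at hx
      rw [openGap, if_pos (by omega), add_comm]
    rw [this]
    exact isJRun_range' hj hc
  · have : (List.range' (j * p + 1) (j * c)).map (openGap i (j * d)) =
        List.range' (j * p + 1) (j * c) := by
      refine (List.map_congr_left fun x hx => ?_).trans (List.map_id _)
      rw [mem_run, Finset.mem_Icc] at hx
      rw [openGap, if_neg (by omega)]; rfl
    rw [this]
    exact isJRun_range' hj hc

/-- Closing a gap of length divisible by `j` beside a `j`-run keeps it a `j`-run, and this run does
not straddle the position where the gap was. -/
theorem isJRun_map_closeGap {j q d p c : ℕ} (hj : 0 < j) (hc : 0 < c) (hd : 0 < d)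
    (hg : ∀ x ∈ List.range' (j * p + 1) (j * c), x ∉ Finset.Icc (j * q + 1) (j * q + j * d)) :
    IsJRun j ((List.range' (j * p + 1) (j * c)).map (closeGap (j * q) (j * d))) ∧
    ¬ (j * q ∈ (List.range' (j * p + 1) (j * c)).map (closeGap (j * q) (j * d)) ∧
      j * q + 1 ∈ (List.range' (j * p + 1) (j * c)).map (closeGap (j * q) (j * d))) := by
  have h := Nat.mul_pos hj hc
  have h' := Nat.mul_pos hj hd
  simp only [mem_run, Finset.mem_Icc] at hg
  rcases lt_or_ge p q with hpq | hpq
  · have hlt : j * p + j * c ≤ j * q := by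
      have h1 := Nat.mul_lt_mul_of_pos_left hpq hj
      by_contra hcon
      exact hg (j * q + 1) (by omega) (by omega)
    have : (List.range' (j * p + 1) (j * c)).map (closeGap (j * q) (j * d)) =
        List.range' (j * p + 1) (j * c) := by
      refine (List.map_congr_left fun x hx => ?_).trans (List.map_id _)
      rw [mem_run, Finset.mem_Icc] at hx
      rw [closeGap, if_neg (by omega)]; rfl
    rw [this]
    refine ⟨isJRun_range' hj hc, ?_⟩
    simp only [mem_run, Finset.mem_Icc]
    omega
  · have h1 := Nat.mul_le_mul_left j hpq
    have h2 : j * (q + d) ≤ j * p := by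
      have := hg (j * p + 1) (by omega)
      rw [Nat.mul_add]
      omega
    obtain ⟨e, rfl⟩ := Nat.exists_eq_add_of_le (Nat.le_of_mul_le_mul_left h2 hj)
    have : (List.range' (j * (q + d + e) + 1) (j * c)).map (closeGap (j * q) (j * d)) =
        List.range' (j * (q + e) + 1) (j * c) := by
      rw [show j * (q + d + e) + 1 = j * d + (j * (q + e) + 1) by ring,
        ← List.map_add_range' (a := j * d), List.map_map]
      refine (List.map_congr_left fun x hx => ?_).trans (List.map_id _)
      rw [mem_run, Finset.mem_Icc, Nat.mul_add] at hx
      rw [Function.comp_apply, closeGap, if_pos (by omega), Nat.add_sub_cancel_left]; rfl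
    rw [this]
    refine ⟨isJRun_range' hj hc, ?_⟩
    simp only [mem_run, Finset.mem_Icc, Nat.mul_add]
    omega

/-! ### Members with marked `j`-runs -/

open scoped Classical in
/-- The blocks of `π` that are `j`-runs. -/
noncomputable def jRuns (j : ℕ) (π : Finset (List ℕ)) : Finset (List ℕ) :=
  π.filter (IsJRun j)

theorem jRuns_subset (j : ℕ) (π : Finset (List ℕ)) : jRuns j π ⊆ π := by
  classical exact Finset.filter_subset _ _

theorem numJRuns_eq_card (j : ℕ) (π : Finset (List ℕ)) : numJRuns j π = (jRuns j π).card := by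
  rw [numJRuns, ← Set.ncard_coe_finset]
  congr 1
  ext R
  simp [jRuns]

/-- `M` is a set of `m` blocks of `π ∈ F`, all of them `j`-runs, of total length `j * t`, and the
rest of `π` has size `u`. -/
structure IsMarking (j : ℕ) (F : Set (Finset (List ℕ))) (u t m : ℕ) (π M : Finset (List ℕ)) :
    Prop where
  mem : π ∈ F
  size_eq : size j π = u + t
  subset : M ⊆ π
  isJRun : ∀ R ∈ M, IsJRun j R
  card_eq : M.card = m
  length_eq : ∑ R ∈ M, R.length / j = t

/-- The positions `p ≤ size π` for which inserting a run after the entry `j * p` splits no block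
in `M`. -/
def freePositions (j : ℕ) (π M : Finset (List ℕ)) : Finset ℕ :=
  {p ∈ Finset.range (size j π + 1) | ∀ R ∈ M, ¬ (j * p ∈ R ∧ j * p + 1 ∈ R)}

theorem zero_notMem_block {π : Finset (List ℕ)} {N : ℕ} (h : support π = Finset.Icc 1 N)
    {B : List ℕ} (hB : B ∈ π) : 0 ∉ B := fun h0 => by
  have : 0 ∈ support π := mem_support.2 ⟨B, hB, h0⟩
  simp [h] at this

variable {j : ℕ} {F : Set (Finset (List ℕ))} {u t m : ℕ} {π M : Finset (List ℕ)}

theorem IsMarking.exists_eq (hF : IsJRunClosed j F) (h : IsMarking j F u t m π M) {R : List ℕ}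
    (hR : R ∈ M) : ∃ p c, 0 < c ∧ R = List.range' (j * p + 1) (j * c) := by
  obtain ⟨N, hN⟩ := hF.isStandard π h.mem
  exact (h.isJRun R hR).exists_eq (zero_notMem_block hN (h.subset hR))

theorem run_length_div (hj : 0 < j) (i c : ℕ) : (List.range' i (j * c)).length / j = c := by
  rw [List.length_range', Nat.mul_div_cancel_left _ hj]

theorem size_eq_div {N : ℕ} (h : support π = Finset.Icc 1 N) : size j π = N / j := by
  simp [size, h]

theorem mul_le_of_le_size {N p : ℕ} (h : support π = Finset.Icc 1 N) (hp : p ≤ size j π) :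
    j * p ≤ N := by
  rw [size_eq_div h] at hp
  exact (Nat.mul_le_mul_left j hp).trans (Nat.mul_div_le N j)

theorem map_openGap_injective (i l : ℕ) : Function.Injective (List.map (openGap i l)) :=
  List.map_injective_iff.2 (openGap_injective i l)

/-- Inserting a run at a free position and marking it. -/
theorem IsMarking.insertRun (hj : 0 < j) (hF : IsJRunClosed j F) {s p : ℕ}
    (h : IsMarking j F u s m π M) (hst : s < t) (hp : p ∈ freePositions j π M) :
    IsMarking j F u t (m + 1) (insertRun π (j * p) (j * (t - s)))
      (insert (List.range' (j * p + 1) (j * (t - s)))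
        (M.image (List.map (openGap (j * p) (j * (t - s)))))) := by
  obtain ⟨N, hN⟩ := hF.isStandard π h.mem
  obtain ⟨hp, hfree⟩ := Finset.mem_filter.1 hp
  have hpN : j * p ≤ N := mul_le_of_le_size hN (by simpa [Nat.lt_succ_iff] using hp)
  have hc : 0 < t - s := by omega
  have hrun := isJRun_range' (p := p) hj hc
  have hnot := run_notMem_image_openGap (i := j * p) (Nat.mul_pos hj hc) M
  refine ⟨hF.insert_mem π h.mem _ _ (by simpa [hN] using hpN) hrun, ?_, ?_, ?_, ?_, ?_⟩
  · have hs := h.size_eq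
    rw [size_eq_div hN] at hs
    rw [size_eq_div (support_insertRun _ hN hpN), Nat.add_mul_div_left _ _ hj]
    omega
  · rw [insertRun_eq]
    exact Finset.insert_subset_insert _ (Finset.image_subset_image h.subset)
  · intro R hR
    rcases Finset.mem_insert.1 hR with rfl | hR
    · exact hrun
    · obtain ⟨B, hB, rfl⟩ := Finset.mem_image.1 hR
      obtain ⟨q, c, hc, rfl⟩ := h.exists_eq hF hB
      exact isJRun_map_openGap hj hc (hfree _ hB)
  · rw [Finset.card_insert_of_notMem hnot,
      Finset.card_image_of_injective _ (map_openGap_injective _ _), h.card_eq]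
  · rw [Finset.sum_insert hnot, run_length_div hj,
      Finset.sum_image (map_openGap_injective _ _).injOn]
    simp only [List.length_map, h.length_eq]
    omega

/-- Every marked run arises by insertion at a free position. -/
theorem IsMarking.exists_insertRun (hj : 0 < j) (hF : IsJRunClosed j F)
    (h : IsMarking j F u t (m + 1) π M) {R : List ℕ} (hR : R ∈ M) :
    ∃ s < t, ∃ π' M', IsMarking j F u s m π' M' ∧ ∃ p ∈ freePositions j π' M',
      SPartition.insertRun π' (j * p) (j * (t - s)) = π ∧
      insert (List.range' (j * p + 1) (j * (t - s)))
        (M'.image (List.map (openGap (j * p) (j * (t - s))))) = M ∧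
      List.range' (j * p + 1) (j * (t - s)) = R := by
  obtain ⟨N, hN⟩ := hF.isStandard π h.mem
  have hπ := hF.isSPartition π h.mem
  obtain ⟨p, c, hc, rfl⟩ := h.exists_eq hF hR
  have hRπ := h.subset hR
  have hl := Nat.mul_pos hj hc
  have hle := run_le_of_mem hl hN hRπ
  have hlen := h.length_eq
  rw [← Finset.add_sum_erase _ _ hR, run_length_div hj] at hlen
  have hct : t - (t - c) = c := by omega
  have hgap : ∀ B ∈ M.erase (List.range' (j * p + 1) (j * c)), ∀ x ∈ B,
      x ∉ Finset.Icc (j * p + 1) (j * p + j * c) := fun B hB x hx =>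
    hπ.notMem_gap hRπ (Finset.erase_subset_erase _ h.subset hB) hx
  have hclose : ∀ B ∈ M.erase (List.range' (j * p + 1) (j * c)),
      IsJRun j (B.map (closeGap (j * p) (j * c))) ∧
      ¬ (j * p ∈ B.map (closeGap (j * p) (j * c)) ∧
        j * p + 1 ∈ B.map (closeGap (j * p) (j * c))) := fun B hB => by
    obtain ⟨q, d, hd, rfl⟩ := h.exists_eq hF (Finset.mem_of_mem_erase hB)
    exact isJRun_map_closeGap hj hd hc (hgap _ hB)
  have hinj : Set.InjOn (List.map (closeGap (j * p) (j * c)))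
      (M.erase (List.range' (j * p + 1) (j * c))) := fun B hB B' hB' e => by
    rw [← map_openGap_map_closeGap (hgap B hB), e, map_openGap_map_closeGap (hgap B' hB')]
  have hsupp := support_deleteRun hπ hl hN hRπ
  have hsize : size j (deleteRun π (List.range' (j * p + 1) (j * c))) = u + (t - c) := by
    have hs := h.size_eq
    rw [size_eq_div hN] at hs
    rw [size_eq_div hsupp, Nat.sub_mul_div, hs]
    omega
  have hpsize : p ≤ size j (deleteRun π (List.range' (j * p + 1) (j * c))) := by
    rw [size_eq_div hsupp, Nat.le_div_iff_mul_le hj, mul_comm]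
    omega
  refine ⟨t - c, by omega, deleteRun π (List.range' (j * p + 1) (j * c)),
    (M.erase (List.range' (j * p + 1) (j * c))).image (List.map (closeGap (j * p) (j * c))),
    ⟨hF.delete_mem π h.mem _ hRπ (h.isJRun _ hR), hsize, ?_, ?_, ?_, ?_⟩, p, ?_, ?_, ?_, ?_⟩
  · rw [deleteRun_eq hπ hl hN hRπ]
    exact Finset.image_subset_image (Finset.erase_subset_erase _ h.subset)
  · intro B hB
    obtain ⟨C, hC, rfl⟩ := Finset.mem_image.1 hB
    exact (hclose C hC).1
  · rw [Finset.card_image_of_injOn hinj, Finset.card_erase_of_mem hR, h.card_eq,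
      Nat.add_sub_cancel]
  · rw [Finset.sum_image hinj]
    simp only [List.length_map]
    omega
  · refine Finset.mem_filter.2 ⟨Finset.mem_range.2 (by omega), fun B hB => ?_⟩
    obtain ⟨C, hC, rfl⟩ := Finset.mem_image.1 hB
    exact (hclose C hC).2
  · rw [hct, insertRun_deleteRun hπ hl hN hRπ]
  · rw [hct, image_openGap_image_closeGap hgap, Finset.insert_erase hR]
  · rw [hct]

theorem insert_image_openGap_injective {i l : ℕ} (hl : 0 < l) {A B : Finset (List ℕ)}
    (h : insert (List.range' (i + 1) l) (A.image (List.map (openGap i l))) =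
      insert (List.range' (i + 1) l) (B.image (List.map (openGap i l)))) : A = B := by
  have := congrArg (fun s => s.erase (List.range' (i + 1) l)) h
  simp only [Finset.erase_insert (run_notMem_image_openGap hl _)] at this
  exact Finset.image_injective (map_openGap_injective i l) this

theorem card_filter_run {n p c : ℕ} (hj : 0 < j) (hc : 0 < c) (hn : p + c ≤ n) :
    ((Finset.range (n + 1)).filter fun q => j * q ∈ List.range' (j * p + 1) (j * c) ∧
      j * q + 1 ∈ List.range' (j * p + 1) (j * c)).card + 1 = c := by
  have : ((Finset.range (n + 1)).filter fun q => j * q ∈ List.range' (j * p + 1) (j * c) ∧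
      j * q + 1 ∈ List.range' (j * p + 1) (j * c)) = Finset.Ioo p (p + c) := by
    ext q
    simp only [Finset.mem_filter, Finset.mem_range, mem_run, Finset.mem_Icc, Finset.mem_Ioo,
      ← Nat.mul_add]
    have h1 := mul_lt_mul_iff_right₀ (b := p) (c := q) hj
    have h2 := mul_lt_mul_iff_right₀ (b := q) (c := p + c) hj
    omega
  rw [this, Nat.card_Ioo]
  omega

/-- A `j`-run of length `j * c` rules out `c - 1` of the `u + t + 1` positions. -/
theorem IsMarking.card_freePositions (hj : 0 < j) (hF : IsJRunClosed j F)
    (h : IsMarking j F u t m π M) : (freePositions j π M).card = u + m + 1 := by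
  obtain ⟨N, hN⟩ := hF.isStandard π h.mem
  have hπ := hF.isSPartition π h.mem
  set I : List ℕ → Finset ℕ := fun R =>
    (Finset.range (size j π + 1)).filter fun q => j * q ∈ R ∧ j * q + 1 ∈ R with hI
  -- The positions that are not free lie inside exactly one marked run, since blocks are disjoint.
  have hcompl : (Finset.range (size j π + 1)).filter
      (fun p => ¬ ∀ R ∈ M, ¬ (j * p ∈ R ∧ j * p + 1 ∈ R)) = M.biUnion I := by
    ext p
    simp only [hI, Finset.mem_filter, Finset.mem_biUnion]
    push Not
    tauto
  have hdisj : (M : Set (List ℕ)).PairwiseDisjoint I := fun R hR R' hR' hne =>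
    Finset.disjoint_left.2 fun q hq hq' =>
      hπ.disjoint R (h.subset hR) R' (h.subset hR') hne (Finset.mem_filter.1 hq).2.1
        (Finset.mem_filter.1 hq').2.1
  have hadd := Finset.card_filter_add_card_filter_not (s := Finset.range (size j π + 1))
    (fun p => ∀ R ∈ M, ¬ (j * p ∈ R ∧ j * p + 1 ∈ R))
  have hsum : ∑ R ∈ M, (I R).card + m = t := by
    rw [← h.length_eq, ← h.card_eq, Finset.card_eq_sum_ones, ← Finset.sum_add_distrib]
    refine Finset.sum_congr rfl fun R hR => ?_
    obtain ⟨p, c, hc, rfl⟩ := h.exists_eq hF hR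
    rw [run_length_div hj]
    refine card_filter_run hj hc ?_
    have := run_le_of_mem (Nat.mul_pos hj hc) hN (h.subset hR)
    rwa [← Nat.mul_add, mul_comm, ← Nat.le_div_iff_mul_le hj, ← size_eq_div hN] at this
  rw [hcompl, Finset.card_biUnion hdisj, Finset.card_range, h.size_eq] at hadd
  unfold freePositions
  rw [h.size_eq]
  omega

/-- The members of `F` of size `n`. -/
noncomputable def members (hj : 0 < j) (hF : IsJRunClosed j F) (n : ℕ) :
    Finset (Finset (List ℕ)) :=
  Set.Finite.toFinset (s := {π | π ∈ F ∧ size j π = n}) <|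
    (finite_size hj n).subset fun π h =>
      ⟨hF.isSPartition π h.1, hF.isStandard π h.1, h.2⟩

theorem mem_members {hj : 0 < j} {hF : IsJRunClosed j F} {n : ℕ} :
    π ∈ members hj hF n ↔ π ∈ F ∧ size j π = n := by
  simp [members]

/-- The pairs of a member of `F` and a set of `m` marked `j`-runs in it, of total length `j * t`,
where the unmarked blocks make up the size `u`. -/
noncomputable def markings (hj : 0 < j) (hF : IsJRunClosed j F) (u t m : ℕ) :
    Finset ((_ : Finset (List ℕ)) × Finset (List ℕ)) :=
  (members hj hF (u + t)).sigma fun π =>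
    {M ∈ (jRuns j π).powersetCard m | ∑ R ∈ M, R.length / j = t}

theorem mem_markings {hj : 0 < j} {hF : IsJRunClosed j F} :
    (⟨π, M⟩ : (_ : Finset (List ℕ)) × Finset (List ℕ)) ∈ markings hj hF u t m ↔
      IsMarking j F u t m π M := by
  simp only [markings, Finset.mem_sigma, mem_members, Finset.mem_filter, Finset.mem_powersetCard,
    jRuns, Finset.subset_iff]
  constructor
  · rintro ⟨⟨h1, h2⟩, ⟨h3, h4⟩, h5⟩
    exact ⟨h1, h2, fun R hR => (h3 hR).1, fun R hR => (h3 hR).2, h4, h5⟩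
  · rintro ⟨h1, h2, h3, h4, h5, h6⟩
    exact ⟨⟨h1, h2⟩, ⟨fun R hR => ⟨h3 hR, h4 R hR⟩, h5⟩, h6⟩

/-- Double counting of the markings with one distinguished marked run: delete that run, remembering
its length and its position among the `u + m + 1` free ones. -/
theorem card_markings_succ (hj : 0 < j) (hF : IsJRunClosed j F) (u t m : ℕ) :
    (m + 1) * (markings hj hF u t (m + 1)).card =
      (u + m + 1) * ∑ s ∈ Finset.range t, (markings hj hF u s m).card := by
  have hl : ((markings hj hF u t (m + 1)).sigma fun q => q.2).card =
      (m + 1) * (markings hj hF u t (m + 1)).card := by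
    rw [Finset.card_sigma, Finset.sum_const_nat (m := m + 1), mul_comm]
    exact fun q hq => (mem_markings.1 hq).card_eq
  have hr : ((Finset.range t).sigma fun s => (markings hj hF u s m).sigma fun q =>
      freePositions j q.1 q.2).card =
      (u + m + 1) * ∑ s ∈ Finset.range t, (markings hj hF u s m).card := by
    rw [Finset.card_sigma, Finset.mul_sum]
    refine Finset.sum_congr rfl fun s _ => ?_
    rw [Finset.card_sigma, Finset.sum_const_nat (m := u + m + 1), mul_comm]
    exact fun q hq => (mem_markings.1 hq).card_freePositions hj hF
  rw [← hl, ← hr]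
  symm
  refine Finset.card_bij (fun a _ =>
    ⟨⟨insertRun a.2.1.1 (j * a.2.2) (j * (t - a.1)),
      insert (List.range' (j * a.2.2 + 1) (j * (t - a.1)))
        (a.2.1.2.image (List.map (openGap (j * a.2.2) (j * (t - a.1)))))⟩,
      List.range' (j * a.2.2 + 1) (j * (t - a.1))⟩) ?_ ?_ ?_
  · rintro ⟨s, ⟨π, M⟩, p⟩ h
    simp only [Finset.mem_sigma, Finset.mem_range, mem_markings] at h ⊢
    exact ⟨h.2.1.insertRun hj hF h.1 h.2.2, Finset.mem_insert_self _ _⟩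
  · rintro ⟨s, ⟨π, M⟩, p⟩ h ⟨s', ⟨π', M'⟩, p'⟩ h' e
    simp only [Finset.mem_sigma, Finset.mem_range] at h h'
    simp only [Sigma.mk.injEq, heq_eq_eq] at e
    obtain ⟨⟨e1, e2⟩, e3⟩ := e
    have hlen := congrArg List.length e3
    simp only [List.length_range'] at hlen
    have hs := Nat.eq_of_mul_eq_mul_left hj hlen
    obtain rfl : s = s' := by omega
    have hpos : 0 < j * (t - s) := Nat.mul_pos hj (by omega)
    have hp : j * p = j * p' := by
      have := List.range'_inj.1 e3
      omega
    obtain rfl := Nat.eq_of_mul_eq_mul_left hj hp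
    obtain rfl := insert_image_openGap_injective hpos e1
    obtain rfl := insert_image_openGap_injective hpos e2
    rfl
  · rintro ⟨⟨π, M⟩, R⟩ h
    simp only [Finset.mem_sigma, mem_markings] at h
    obtain ⟨s, hs, π', M', h', p, hp, e1, e2, e3⟩ := h.1.exists_insertRun hj hF h.2
    refine ⟨⟨s, ⟨π', M'⟩, p⟩, ?_, ?_⟩
    · simp only [Finset.mem_sigma, Finset.mem_range, mem_markings]
      exact ⟨hs, h', hp⟩
    · subst e1 e2 e3
      rfl

/-- The marked runs are disjoint, so their total size is at most that of the s-partition. -/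
theorem sum_length_div_le_size (hπ : IsSPartition π) (hM : M ⊆ π) :
    ∑ R ∈ M, R.length / j ≤ size j π := by
  rcases Nat.eq_zero_or_pos j with rfl | hj
  · simp [size]
  rw [size, Nat.le_div_iff_mul_le hj, Finset.sum_mul]
  calc ∑ R ∈ M, R.length / j * j ≤ ∑ R ∈ M, R.toFinset.card := by
        refine Finset.sum_le_sum fun R hR => ?_
        rw [List.toFinset_card_of_nodup (hπ.nodup R (hM hR))]
        exact Nat.div_mul_le_self _ _
    _ = (M.biUnion List.toFinset).card := by
        rw [Finset.card_biUnion]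
        exact fun R hR R' hR' hne => List.disjoint_toFinset_iff_disjoint.2
          (hπ.disjoint R (hM hR) R' (hM hR') hne)
    _ ≤ (support π).card := Finset.card_le_card (Finset.biUnion_subset_biUnion_of_subset_left _ hM)

theorem card_markings_zero (hj : 0 < j) (hF : IsJRunClosed j F) (u t : ℕ) :
    (markings hj hF u t 0).card = if t = 0 then (members hj hF u).card else 0 := by
  rw [markings, Finset.card_sigma]
  split_ifs with h
  · subst h
    simp [Finset.filter_singleton, -Finset.sum_eq_zero_iff]
  · simp [Finset.filter_singleton, Ne.symm h]

/-- Sorting all pairs of a member of size `n` and `m` of its `j`-runs by the marked length. -/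
theorem sum_card_markings (hj : 0 < j) (hF : IsJRunClosed j F) (n m : ℕ) :
    ∑ ut ∈ Finset.HasAntidiagonal.antidiagonal n, (markings hj hF ut.1 ut.2 m).card =
      ∑ π ∈ members hj hF n, (numJRuns j π).choose m := by
  have h1 : ∀ ut ∈ Finset.HasAntidiagonal.antidiagonal n, (markings hj hF ut.1 ut.2 m).card =
      ∑ π ∈ members hj hF n,
        {M ∈ (jRuns j π).powersetCard m | ∑ R ∈ M, R.length / j = ut.2}.card := fun ut h => by
    rw [markings, Finset.card_sigma, Finset.HasAntidiagonal.mem_antidiagonal.1 h]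
  rw [Finset.sum_congr rfl h1, Finset.sum_comm]
  refine Finset.sum_congr rfl fun π hπ => ?_
  rw [mem_members] at hπ
  rw [Finset.Nat.sum_antidiagonal_eq_sum_range_succ_mk, numJRuns_eq_card,
    ← Finset.card_powersetCard, ← Finset.sum_range_reflect]
  rw [Finset.card_eq_sum_card_fiberwise (t := Finset.range n.succ)
    (f := fun M => ∑ R ∈ M, R.length / j)]
  · refine Finset.sum_congr rfl fun i hi => ?_
    rw [Finset.mem_range] at hi
    simp only [show n - (n.succ - 1 - i) = i by omega]
  · intro M hM
    have hM := (Finset.mem_powersetCard.1 hM).1.trans (jRuns_subset j π)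
    have := sum_length_div_le_size (j := j) (hF.isSPartition π hπ.1) hM
    simp only [Finset.coe_range, Set.mem_Iio]
    omega

/-! ### Powers of the run factor -/

open PowerSeries in
/-- The generating series `x / (1 - x)` of the possible sizes of one run. -/
noncomputable def runSeries : PowerSeries ℤ := X * mk fun _ => 1

open PowerSeries in
theorem one_sub_X_mul_runSeries : (1 - X) * runSeries = X := by
  have : (1 - X : PowerSeries ℤ) * mk (fun _ => 1) = 1 := by
    rw [mul_comm]; exact mk_one_mul_one_sub_eq_one ℤ
  rw [runSeries, mul_left_comm, this, mul_one]

open PowerSeries in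
theorem coeff_runSeries_mul (g : PowerSeries ℤ) (t : ℕ) :
    coeff t (runSeries * g) = ∑ s ∈ Finset.range t, coeff s g := by
  rw [runSeries, mul_assoc, mul_comm _ g]
  cases t with
  | zero => simp
  | succ t =>
    rw [coeff_succ_X_mul, coeff_mul, Finset.Nat.sum_antidiagonal_eq_sum_range_succ_mk]
    simp

open PowerSeries in
/-- If a power series `a` is divisible by `x`, only finitely many terms contribute to a coefficient
of a substitution. -/
theorem coeff_mul_subst {A B : Type*} [CommRing A] [CommRing B] [Algebra A B]
    {a : PowerSeries B} (ha : X ∣ a) (f : PowerSeries A) (h : PowerSeries B) (n : ℕ) :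
    coeff n (h * subst a f) =
      ∑ d ∈ Finset.range (n + 1), coeff d f • coeff n (h * a ^ d) := by
  have hs : HasSubst a := HasSubst.of_constantCoeff_zero' (X_dvd_iff.1 ha)
  have hc : ∀ e ≤ n, coeff e (subst a f) =
      ∑ d ∈ Finset.range (n + 1), coeff d f • coeff e (a ^ d) := fun e he => by
    rw [coeff_subst' hs]
    refine finsum_eq_sum_of_support_subset _ fun d hd => ?_
    by_contra hdn
    simp only [Finset.coe_range, Set.mem_Iio, not_lt] at hdn
    refine hd ?_
    simp only [X_pow_dvd_iff.1 (pow_dvd_pow_of_dvd ha d) e (by omega), smul_zero]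
  simp only [coeff_mul, Finset.smul_sum]
  rw [Finset.sum_comm]
  refine Finset.sum_congr rfl fun p hp => ?_
  rw [Finset.HasAntidiagonal.mem_antidiagonal] at hp
  rw [hc p.2 (by omega), Finset.mul_sum]
  exact Finset.sum_congr rfl fun d _ => mul_smul_comm _ _ _

open PowerSeries in
theorem coeff_runTransform {A : Type*} [CommRing A] (f : PowerSeries A) (n : ℕ) :
    coeff n (runTransform f) =
      ∑ ut ∈ Finset.HasAntidiagonal.antidiagonal n,
        coeff ut.1 f • coeff ut.2 (runFactor A ^ (ut.1 + 1)) := by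
  rw [runTransform, coeff_mul_subst (dvd_mul_right _ _),
    Finset.Nat.sum_antidiagonal_eq_sum_range_succ_mk]
  refine Finset.sum_congr rfl fun d hd => ?_
  have : runFactor A * (X * runFactor A) ^ d = X ^ d * runFactor A ^ (d + 1) := by ring
  rw [Finset.mem_range] at hd
  obtain ⟨e, rfl⟩ := Nat.exists_eq_add_of_le (Nat.lt_succ_iff.1 hd)
  rw [this, add_comm d e, coeff_X_pow_mul, Nat.add_sub_cancel]

/-- The substitution of `y + 1` for `y`. -/
noncomputable abbrev shiftY : Polynomial ℤ →+* Polynomial ℤ :=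
  (Polynomial.taylorAlgHom (1 : ℤ)).toRingHom

open PowerSeries in
/-- After the shift of `y`, the run factor becomes `1 / (1 - y x / (1 - x))`. -/
theorem map_runFactor_mul :
    PowerSeries.map shiftY (runFactor ℤ) *
      (1 - C (Polynomial.X : Polynomial ℤ) * PowerSeries.map Polynomial.C runSeries) = 1 := by
  have h1 := congrArg (PowerSeries.map shiftY) (runFactor_mul ℤ)
  have h2 := congrArg (PowerSeries.map (Polynomial.C : ℤ →+* Polynomial ℤ)) one_sub_X_mul_runSeries
  simp only [map_mul, map_sub, map_one, PowerSeries.map_X, PowerSeries.map_C] at h1 h2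
  have h3 : shiftY Polynomial.X = Polynomial.X + 1 := by
    simp [shiftY]
  rw [h3, map_add, map_one] at h1
  have hne : (1 - X : PowerSeries (Polynomial ℤ)) ≠ 0 := fun h => by
    have := congrArg (coeff 0) h
    simp at this
  -- Multiplied by `1 - x`, the second factor is `1 - x (y + 1)`, the shifted denominator.
  refine mul_right_cancel₀ hne ?_
  linear_combination h1 - PowerSeries.map shiftY (runFactor ℤ) * C Polynomial.X * h2

open PowerSeries in
/-- The expansion of `(1 - y x / (1 - x)) ^ (-(u + 1))` in powers of `y`. -/
theorem coeff_coeff_map_runFactor_pow (u t m : ℕ) :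
    (coeff t (PowerSeries.map shiftY (runFactor ℤ) ^ (u + 1))).coeff m =
      (u + m).choose u * coeff t (runSeries ^ m) := by
  set a : PowerSeries (Polynomial ℤ) :=
    C (Polynomial.X : Polynomial ℤ) * PowerSeries.map Polynomial.C runSeries with ha
  have hXa : X ∣ a := by
    refine Dvd.dvd.mul_left ?_ _
    rw [runSeries, map_mul, PowerSeries.map_X]
    exact dvd_mul_right _ _
  have hs : HasSubst a := HasSubst.of_constantCoeff_zero' (X_dvd_iff.1 hXa)
  have hsub : PowerSeries.map shiftY (runFactor ℤ) ^ (u + 1) =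
      1 * subst a (invOneSubPow ℤ (u + 1)).val := by
    have h1 : (invOneSubPow ℤ (u + 1)).val * (1 - X) ^ (u + 1) = 1 := by
      rw [← invOneSubPow_inv_eq_one_sub_pow]
      exact (invOneSubPow ℤ (u + 1)).val_inv
    have h2 := congrArg (substAlgHom (R := ℤ) hs) h1
    rw [map_mul, map_pow, map_sub, map_one, substAlgHom_X, coe_substAlgHom] at h2
    have h3 : PowerSeries.map shiftY (runFactor ℤ) ^ (u + 1) * (1 - a) ^ (u + 1) = 1 := by
      rw [← mul_pow, map_runFactor_mul, one_pow]
    rw [one_mul]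
    exact (left_inv_eq_right_inv h2 ((mul_comm _ _).trans h3)).symm
  have hpow : ∀ d, coeff t (1 * a ^ d) = Polynomial.monomial d (coeff t (runSeries ^ d)) :=
    fun d => by
      rw [one_mul, ha, mul_pow, ← map_pow, ← map_pow, coeff_C_mul, coeff_map,
        mul_comm, Polynomial.C_mul_X_pow_eq_monomial]
  rw [hsub, coeff_mul_subst hXa]
  simp only [hpow, invOneSubPow_val_succ_eq_mk_add_choose, coeff_mk, Polynomial.finsetSum_coeff,
    Polynomial.coeff_smul, Polynomial.coeff_monomial, smul_eq_mul, mul_ite, mul_zero]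
  rw [Finset.sum_ite_eq']
  split_ifs with hm
  · rfl
  · have : coeff t (runSeries ^ m) = 0 :=
      X_pow_dvd_iff.1 (pow_dvd_pow_of_dvd (dvd_mul_right _ _) m) t
        (by simpa [Nat.lt_succ_iff] using hm)
    rw [this, mul_zero]

/-! ### Comparison of the coefficients -/

open PowerSeries in
/-- There are `C(u + m, m)` ways to distribute `m` runs over `u + 1` positions, and the coefficients
of `runSeries ^ m` count their sizes. -/
theorem card_markings {j : ℕ} {F : Set (Finset (List ℕ))} (hj : 0 < j) (hF : IsJRunClosed j F)
    (u m t : ℕ) : ((markings hj hF u t m).card : ℤ) =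
      (members hj hF u).card * ((u + m).choose u * coeff t (runSeries ^ m)) := by
  induction m generalizing t with
  | zero => rw [card_markings_zero, pow_zero, coeff_one]; split_ifs <;> simp
  | succ m ih =>
    have h := congrArg (Nat.cast (R := ℤ)) (card_markings_succ hj hF u t m)
    push_cast at h
    simp only [ih] at h
    rw [← Finset.mul_sum, ← Finset.mul_sum, ← coeff_runSeries_mul, ← pow_succ'] at h
    have hc : ((m : ℤ) + 1) * (u + (m + 1)).choose u = (u + m + 1) * (u + m).choose u := by
      have := Nat.add_one_mul_choose_eq (u + m) m
      rw [Nat.choose_symm_add, Nat.choose_symm_add]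
      exact_mod_cast (mul_comm _ _).trans this.symm
    refine mul_left_cancel₀ (show (m : ℤ) + 1 ≠ 0 by positivity) (h.trans ?_)
    linear_combination (-(members hj hF u).card * coeff t (runSeries ^ (m + 1))) * hc

theorem coeff_sizeGF {j : ℕ} {F : Set (Finset (List ℕ))} (hj : 0 < j) (hF : IsJRunClosed j F)
    (n : ℕ) : PowerSeries.coeff n (sizeGF j F) = (members hj hF n).card := by
  rw [sizeGF, PowerSeries.coeff_mk, ← Set.ncard_coe_finset]
  congr 2
  ext π
  simp [mem_members]

/-- The coefficients of the run transform are the polynomials `∑ y ^ numJRuns π`; this is checked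
after replacing `y` by `y + 1`, that is, by counting members with marked `j`-runs. -/
theorem coeff_runTransform_sizeGF {j : ℕ} {F : Set (Finset (List ℕ))} (hj : 0 < j)
    (hF : IsJRunClosed j F) (n : ℕ) :
    PowerSeries.coeff n (runTransform (sizeGF j F)) =
      ∑ π ∈ members hj hF n, (Polynomial.X : Polynomial ℤ) ^ numJRuns j π := by
  apply Polynomial.taylor_injective (1 : ℤ)
  change shiftY _ = shiftY _
  have hX : shiftY Polynomial.X = Polynomial.X + 1 := by simp [shiftY]
  ext m
  rw [coeff_runTransform, map_sum, map_sum, Polynomial.finsetSum_coeff,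
    Polynomial.finsetSum_coeff]
  have hr : ∀ π : Finset (List ℕ), (shiftY (Polynomial.X ^ numJRuns j π)).coeff m =
      ((numJRuns j π).choose m : ℤ) := fun π => by
    rw [map_pow, hX, Polynomial.coeff_X_add_one_pow]
  simp only [hr]
  have h := congrArg (Nat.cast (R := ℤ)) (sum_card_markings hj hF n m)
  push_cast at h
  rw [← h]
  refine Finset.sum_congr rfl fun ut _ => ?_
  rw [card_markings, ← coeff_coeff_map_runFactor_pow, ← coeff_sizeGF, ← map_pow,
    PowerSeries.coeff_map, ← smul_eq_mul, ← Polynomial.coeff_smul]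
  exact congrArg (Polynomial.coeff · m) (map_smul (Polynomial.taylorAlgHom (1 : ℤ)) _ _)

end SPartition

theorem theorem15 (j : ℕ) (hj : 0 < j) (F : Set (Finset (List ℕ)))
    (hF : SPartition.IsJRunClosed j F) (n k : ℕ) :
    (PowerSeries.coeff n (SPartition.runTransform (SPartition.sizeGF j F))).coeff k =
      (({π | π ∈ F ∧ SPartition.size j π = n ∧ SPartition.numJRuns j π = k}.ncard : ℕ) : ℤ) := by
  rw [SPartition.coeff_runTransform_sizeGF hj hF, Polynomial.finsetSum_coeff]
  simp only [Polynomial.coeff_X_pow]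
  rw [Finset.sum_boole, ← Set.ncard_coe_finset]
  congr 2
  ext π
  simp [SPartition.mem_members, and_assoc, eq_comm]
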